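/- For integers $n\ge 2$ and $1\le i<j\le n$, consider the hyperplanes of $\mathbb{R}^n$ $$C_{ij}=\{x\mid x_i=x_j\},\qquad S_{ij}=\{x\mid x_i=x_j+1\},\qquad I_{ij}=\{x\mid x_1=x_j+i\}.$$ Let $\mathrm{Shi}_n=\{C_{ij},S_{ij}\mid 1\le i<j\le n\}$ and $\mathrm{Ish}_n=\{C_{ij},I_{ij}\mid 1\le i<j\le n\}$ be the Shi and the Ish arrangement. For $1\le k<n$ let $\mathcal{A}^{(k,n)}$ be the arrangement formed by all $C_{ij}$ with $1\le i<j\le n$, all $S_{ij}$ with $k<i<j\le n$, and all $I_{ij}$ with $1\le i\le k$ and $i<j\le n$. The characteristic polynomial of a finite arrangement $\mathcal{A}$ of affine hyperplanes in $\mathbb{R}^n$ is $$\chi(\mathcal{A},q)=\sum_{F\in L(\mathcal{A})}\mu(\mathbb{R}^n,F)\,q^{\dim F},$$ where $L(\mathcal{A})$ is the set of nonempty intersections of subfamilies of $\mathcal{A}$ (including $\mathbb{R}^n$, the empty intersection), ordered by reverse inclusion, and $\mu$ is its Möbius function. **Theorem.** For all integers $1\le k<n$, $$\chi(\mathcal{A}^{(k,n)},q)=q(q-n)^{n-1}.$$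 In particular this polynomial does not depend on $k$, and $\chi(\mathcal{A}^{(k,n)},q)=\chi(\mathrm{Shi}_n,q)=\chi(\mathrm{Ish}_n,q)$. -/

import Mathlib

noncomputable section

namespace HyperplaneArrangement

open scoped Classical in
/-- The flats of a finite arrangement `A` of affine hyperplanes in `V`: the nonempty intersections
of subfamilies of `A`. The empty subfamily gives the whole space. -/
def flats {V : Type*} [AddCommGroup V] [Module ℝ V] (A : Finset (AffineSubspace ℝ V)) :
    Finset (AffineSubspace ℝ V) :=
  (A.powerset.image fun B : Finset (AffineSubspace ℝ V) =>
      sInf (B : Set (AffineSubspace ℝ V))).filter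
    fun F => (F : Set V).Nonempty

theorem top_mem_flats {V : Type*} [AddCommGroup V] [Module ℝ V]
    (A : Finset (AffineSubspace ℝ V)) : (⊤ : AffineSubspace ℝ V) ∈ flats A := by
  classical
  simp only [flats, Finset.mem_filter, Finset.mem_image]
  exact ⟨⟨∅, by simp, by simp⟩, ⟨0, by simp⟩⟩

/-- The intersection poset `L(A)`: the flats of `A`, ordered by reverse inclusion. -/
abbrev IntersectionPoset {V : Type*} [AddCommGroup V] [Module ℝ V]
    (A : Finset (AffineSubspace ℝ V)) : Type _ :=
  {F : AffineSubspace ℝ V // F ∈ flats A}ᵒᵈ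

/-- The minimum of `L(A)`, which is the whole space. -/
def bottom {V : Type*} [AddCommGroup V] [Module ℝ V] (A : Finset (AffineSubspace ℝ V)) :
    IntersectionPoset A :=
  OrderDual.toDual ⟨⊤, top_mem_flats A⟩

open scoped Classical in
instance instLocallyFiniteOrder {V : Type*} [AddCommGroup V] [Module ℝ V] (A : Finset (AffineSubspace ℝ V)) :
    LocallyFiniteOrder (IntersectionPoset A) :=
  Fintype.toLocallyFiniteOrder

open scoped Classical in
/-- The characteristic polynomial `χ(A, q) = ∑_{F ∈ L(A)} μ(0̂, F) q ^ dim F`, where `μ` is the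
Möbius function of `L(A)` and `0̂` is its minimum. -/
def charPoly {V : Type*} [AddCommGroup V] [Module ℝ V] (A : Finset (AffineSubspace ℝ V)) :
    Polynomial ℤ :=
  ∑ F : IntersectionPoset A,
    Polynomial.C (IncidenceAlgebra.mu ℤ (bottom A) F) *
      Polynomial.X ^ Module.finrank ℝ (OrderDual.ofDual F).1.direction

/-- The affine subspace `x_i = x_j + c` of `ℝⁿ`; it is a hyperplane when `i ≠ j`. -/
def differenceHyperplane {n : ℕ} (i j : Fin n) (c : ℝ) : AffineSubspace ℝ (Fin n → ℝ) where
  carrier := {x | x i = x j + c}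
  smul_vsub_vadd_mem' := by
    intro t p q r hp hq hr
    simp only [Set.mem_ofPred_eq, vsub_eq_sub, vadd_eq_add, Pi.add_apply, Pi.smul_apply,
      Pi.sub_apply, smul_eq_mul] at *
    rw [hp, hq, hr]
    ring

/-! The index `i ∈ {1, …, n}` is represented by the element of `Fin n` with value `i - 1`,
so the label of `i : Fin n` is `(i : ℕ) + 1`, and the coordinate `x_1` has index `0`. -/

/-- `C_{ij}`: `x_i = x_j`. -/
def coxHyperplane {n : ℕ} (i j : Fin n) : AffineSubspace ℝ (Fin n → ℝ) :=
  differenceHyperplane i j 0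

/-- `S_{ij}`: `x_i = x_j + 1`. -/
def shiHyperplane {n : ℕ} (i j : Fin n) : AffineSubspace ℝ (Fin n → ℝ) :=
  differenceHyperplane i j 1

/-- `I_{ij}`: `x_1 = x_j + i`. -/
def ishHyperplane {n : ℕ} (i j : Fin n) : AffineSubspace ℝ (Fin n → ℝ) :=
  differenceHyperplane ⟨0, i.pos⟩ j (((i : ℕ) + 1 : ℕ) : ℝ)

/-- The pairs `(i, j)` with `i < j`. -/
def pairs (n : ℕ) : Finset (Fin n × Fin n) :=
  Finset.univ.filter fun p => p.1 < p.2

open scoped Classical in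
/-- The Coxeter arrangement `Cox_n`. -/
def cox (n : ℕ) : Finset (AffineSubspace ℝ (Fin n → ℝ)) :=
  (pairs n).image fun p => coxHyperplane p.1 p.2

open scoped Classical in
/-- The Shi arrangement `Shi_n`. -/
def shi (n : ℕ) : Finset (AffineSubspace ℝ (Fin n → ℝ)) :=
  cox n ∪ (pairs n).image fun p => shiHyperplane p.1 p.2

open scoped Classical in
/-- The Ish arrangement `Ish_n`. -/
def ish (n : ℕ) : Finset (AffineSubspace ℝ (Fin n → ℝ)) :=
  cox n ∪ (pairs n).image fun p => ishHyperplane p.1 p.2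

open scoped Classical in
/-- The arrangement `A^X`, for a set `X` of labels in `{1, …, n}`: the hyperplanes `C_{ij}` for all
`i < j`, `S_{ij}` for `i < j` with `i ∈ X`, and `I_{ij}` for `i < j` with `i ∉ X`. -/
def between (n : ℕ) (X : Finset ℕ) : Finset (AffineSubspace ℝ (Fin n → ℝ)) :=
  cox n ∪
    ((pairs n).filter fun p => (p.1 : ℕ) + 1 ∈ X).image (fun p => shiHyperplane p.1 p.2) ∪
    ((pairs n).filter fun p => (p.1 : ℕ) + 1 ∉ X).image (fun p => ishHyperplane p.1 p.2)

end HyperplaneArrangement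

end

namespace HyperplaneArrangement

/-! The polynomial is found by counting points of (ℤ/m)ⁿ off the arrangement, for all large m.
Whitney's formula (`charPoly_eval_eq`) turns χ into an alternating sum over subsystems of equations
x_i = x_j + c. For large m each subsystem has m^dim solutions mod m, or none if it is inconsistent
over ℝ (`eventually_card_satisfies`). Inclusion-exclusion then gives `eventually_charPoly_eval`; m
need not be prime, because the equations only involve differences.

For the count, fix x_1 = a and write the other coordinates as a - u with 0 ≤ u < m. Then C says that
the u are distinct and nonzero, I gives lower bounds on them, and S forbids one late index from
sitting directly before a larger one. The s = k - 1 early indices are put in last, each into any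
free cell above its bound (`card_placements_succ`). The r = n - k late ones form decreasing runs, so
only the gap between empty cells that receives each index is free (`card_decreasing_runs`). Every
index contributes the same factor m - n, and a contributes m.

Shi and Ish are the cases k = 1 and k = n - 1. -/

/-- The Möbius function `μ(a, ·)` is characterized by its sums over the intervals `[a, b]`. -/
theorem mu_eq_of_sum_Icc {α : Type*} [PartialOrder α] [LocallyFiniteOrder α] [DecidableEq α]
    (a : α) (g : α → ℤ)
    (hg : ∀ b, a ≤ b → ∑ x ∈ Finset.Icc a b, g x = if a = b then 1 else 0) (b : α) (hab : a ≤ b) :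
    IncidenceAlgebra.mu ℤ a b = g b := by
  induction hN : (Finset.Icc a b).card using Nat.strong_induction_on generalizing b with
  | _ N ih =>
    have h1 := IncidenceAlgebra.sum_Icc_mu_right (𝕜 := ℤ) a b
    rw [← hg b hab, Finset.Icc_eq_cons_Ico hab, Finset.sum_cons, Finset.sum_cons] at h1
    have h2 : ∑ x ∈ Finset.Ico a b, IncidenceAlgebra.mu ℤ a x = ∑ x ∈ Finset.Ico a b, g x := by
      refine Finset.sum_congr rfl fun x hx => ?_
      rw [Finset.mem_Ico] at hx
      refine ih _ ?_ x hx.1 rfl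
      rw [← hN]
      exact Finset.card_lt_card (Finset.Icc_ssubset_Icc_right hab le_rfl hx.2)
    linarith

/-! ### Whitney's formula by subsets of hyperplanes -/

section Whitney

variable {V ι : Type*} [AddCommGroup V] [Module ℝ V]

/-- The intersection of the members of a family of affine subspaces indexed by `S`. -/
noncomputable def flat (h : ι → AffineSubspace ℝ V) (S : Finset ι) : AffineSubspace ℝ V :=
  sInf (h '' S)

theorem mem_flat {h : ι → AffineSubspace ℝ V} {S : Finset ι} {x : V} :
    x ∈ flat h S ↔ ∀ e ∈ S, x ∈ h e := by
  simp [flat, AffineSubspace.mem_sInf_iff]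

theorem le_flat_iff {h : ι → AffineSubspace ℝ V} {S : Finset ι} {F : AffineSubspace ℝ V} :
    F ≤ flat h S ↔ ∀ e ∈ S, F ≤ h e := by
  simp [flat, le_sInf_iff]

open scoped Classical in
theorem mem_flats_image {h : ι → AffineSubspace ℝ V} {E : Finset ι} {F : AffineSubspace ℝ V} :
    F ∈ flats (E.image h) ↔ (∃ S ⊆ E, flat h S = F) ∧ (F : Set V).Nonempty := by
  simp only [flats, Finset.mem_filter, Finset.mem_image, Finset.mem_powerset]
  refine and_congr_left fun _ => ⟨?_, ?_⟩
  · rintro ⟨B, hB, rfl⟩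
    obtain ⟨S, hS, rfl⟩ := Finset.subset_image_iff.1 hB
    exact ⟨S, hS, by simp [flat]⟩
  · rintro ⟨S, hS, rfl⟩
    exact ⟨S.image h, Finset.image_subset_image hS, by simp [flat]⟩

open scoped Classical in
theorem flat_mem_flats {h : ι → AffineSubspace ℝ V} {E S : Finset ι} (hS : S ⊆ E)
    (hne : (flat h S : Set V).Nonempty) : flat h S ∈ flats (E.image h) :=
  mem_flats_image.2 ⟨⟨S, hS, rfl⟩, hne⟩

open scoped Classical in
theorem sum_powerset_filter_neg_one_pow (E : Finset ι) (p : ι → Prop) :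
    ∑ S ∈ E.powerset with (∀ e ∈ S, p e), (-1 : ℤ) ^ S.card =
      if ∀ e ∈ E, ¬ p e then 1 else 0 := by
  have : E.powerset.filter (fun S => ∀ e ∈ S, p e) = (E.filter p).powerset := by
    ext S
    simp only [Finset.mem_filter, Finset.mem_powerset, Finset.subset_iff]
    exact ⟨fun H x hx => ⟨H.1 hx, H.2 x hx⟩, fun H => ⟨fun x hx => (H hx).1, fun x hx => (H hx).2⟩⟩
  rw [this, Finset.sum_powerset_neg_one_pow_card]
  simp [Finset.filter_eq_empty_iff]

open scoped Classical in
/-- Whitney's formula for the Möbius function of the intersection poset. -/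
theorem mu_bottom_eq (h : ι → AffineSubspace ℝ V) (E : Finset ι)
    (htop : ∀ e ∈ E, h e ≠ ⊤) (F : IntersectionPoset (E.image h)) :
    IncidenceAlgebra.mu ℤ (bottom (E.image h)) F =
      ∑ S ∈ E.powerset with flat h S = (OrderDual.ofDual F).1, (-1 : ℤ) ^ S.card := by
  have hbot : ∀ G : IntersectionPoset (E.image h), bottom (E.image h) ≤ G := fun G =>
    show (OrderDual.ofDual G).1 ≤ (⊤ : AffineSubspace ℝ V) from le_top
  refine mu_eq_of_sum_Icc (bottom (E.image h)) (fun G : IntersectionPoset (E.image h) =>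
    ∑ S ∈ E.powerset with flat h S = (OrderDual.ofDual G).1, (-1 : ℤ) ^ S.card) ?_ F (hbot F)
  intro G _
  -- A subset `S` determines its flat, so summing over the flats containing `G` and then over `S` is
  -- one sum over all `S` whose hyperplanes all contain `G`.
  have key : ∑ x ∈ Finset.Icc (bottom (E.image h)) G,
      ∑ S ∈ E.powerset with flat h S = (OrderDual.ofDual x).1, (-1 : ℤ) ^ S.card =
      ∑ S ∈ E.powerset with (∀ e ∈ S, (OrderDual.ofDual G).1 ≤ h e), (-1 : ℤ) ^ S.card := by
    rw [Finset.sum_sigma']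
    refine Finset.sum_bij (fun a _ => a.2) ?_ ?_ ?_ ?_
    · rintro ⟨x, S⟩ hx
      simp only [Finset.mem_sigma, Finset.mem_Icc, Finset.mem_filter] at hx ⊢
      refine ⟨hx.2.1, le_flat_iff.1 ?_⟩
      rw [hx.2.2]
      exact hx.1.2
    · rintro ⟨x, S⟩ hx ⟨y, T⟩ hy hST
      simp only [Finset.mem_sigma, Finset.mem_Icc, Finset.mem_filter] at hx hy hST
      subst hST
      have : x = y := by
        apply OrderDual.ofDual.injective
        exact Subtype.ext (hx.2.2.symm.trans hy.2.2)
      rw [this]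
    · intro S hS
      simp only [Finset.mem_filter, Finset.mem_powerset] at hS
      have hle := le_flat_iff.2 hS.2
      have hne : (flat h S : Set V).Nonempty :=
        (mem_flats_image.1 (OrderDual.ofDual G).2).2.mono hle
      refine ⟨⟨OrderDual.toDual ⟨flat h S, flat_mem_flats hS.1 hne⟩, S⟩, ?_, rfl⟩
      simp only [Finset.mem_sigma, Finset.mem_Icc, Finset.mem_filter, Finset.mem_powerset]
      exact ⟨⟨hbot _, hle⟩, hS.1, rfl⟩
    · intros; rfl
  -- The alternating sum vanishes unless no hyperplane contains `G`; as `G` is an intersection of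
  -- hyperplanes, it is then the whole space.
  rw [key, sum_powerset_filter_neg_one_pow]
  refine if_congr ⟨?_, ?_⟩ rfl rfl
  · intro H
    obtain ⟨⟨S, hS, hSG⟩, -⟩ := mem_flats_image.1 (OrderDual.ofDual G).2
    have : S = ∅ := by
      refine Finset.eq_empty_of_forall_notMem fun e he => H e (hS he) ?_
      exact le_flat_iff.1 hSG.ge e he
    subst this
    apply OrderDual.ofDual.injective
    refine Subtype.ext ?_
    rw [← hSG]
    simp [flat, bottom]
  · rintro rfl e he H
    exact htop e he (top_le_iff.1 H)

open scoped Classical in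
/-- Whitney's formula for the characteristic polynomial. -/
theorem charPoly_eval_eq (h : ι → AffineSubspace ℝ V) (E : Finset ι)
    (htop : ∀ e ∈ E, h e ≠ ⊤) (q : ℤ) :
    (charPoly (E.image h)).eval q =
      ∑ S ∈ E.powerset, (-1 : ℤ) ^ S.card * if (flat h S : Set V).Nonempty then
        q ^ Module.finrank ℝ (flat h S).direction else 0 := by
  simp only [charPoly, Polynomial.eval_finsetSum, Polynomial.eval_mul, Polynomial.eval_C,
    Polynomial.eval_pow, Polynomial.eval_X, mul_ite, mul_zero]
  rw [← Finset.sum_filter]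
  simp only [mu_bottom_eq h E htop, Finset.sum_mul]
  rw [Finset.sum_sigma']
  refine Finset.sum_bij (fun a _ => a.2) ?_ ?_ ?_ ?_
  · rintro ⟨x, S⟩ hx
    simp only [Finset.mem_sigma, Finset.mem_filter] at hx ⊢
    refine ⟨hx.2.1, ?_⟩
    rw [hx.2.2]
    exact (mem_flats_image.1 (OrderDual.ofDual x).2).2
  · rintro ⟨x, S⟩ hx ⟨y, T⟩ hy hST
    simp only [Finset.mem_sigma, Finset.mem_filter] at hx hy hST
    subst hST
    have : x = y := by
      apply OrderDual.ofDual.injective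
      exact Subtype.ext (hx.2.2.symm.trans hy.2.2)
    rw [this]
  · intro S hS
    simp only [Finset.mem_filter, Finset.mem_powerset] at hS
    refine ⟨⟨OrderDual.toDual ⟨flat h S, flat_mem_flats hS.1 hS.2⟩, S⟩, ?_, rfl⟩
    simp only [Finset.mem_sigma, Finset.mem_univ, true_and]
    exact Finset.mem_filter.2 ⟨Finset.mem_powerset.2 hS.1, rfl⟩
  · rintro ⟨x, S⟩ hx
    simp only [Finset.mem_sigma, Finset.mem_filter] at hx
    dsimp only
    rw [hx.2.2]

end Whitney

/-! ### The finite field method for difference equations -/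

section DifferenceEquations

variable {n : ℕ}

/-- The triple `(i, j, c)` encodes the hyperplane `x_i = x_j + c`. -/
noncomputable def tripleHyperplane (e : Fin n × Fin n × ℤ) : AffineSubspace ℝ (Fin n → ℝ) :=
  differenceHyperplane e.1 e.2.1 (e.2.2 : ℝ)

/-- `x` satisfies the equation `x_i = x_j + c` over an arbitrary ring. -/
def Satisfies {R : Type*} [Ring R] (x : Fin n → R) (e : Fin n × Fin n × ℤ) : Prop :=
  x e.1 = x e.2.1 + (e.2.2 : R)

theorem mem_tripleHyperplane {e : Fin n × Fin n × ℤ} {x : Fin n → ℝ} :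
    x ∈ tripleHyperplane e ↔ Satisfies x e := Iff.rfl

theorem tripleHyperplane_ne_top {e : Fin n × Fin n × ℤ} (he : e.1 ≠ e.2.1) :
    tripleHyperplane e ≠ ⊤ := by
  intro H
  have h : Pi.single e.1 ((e.2.2 : ℝ) + 1) ∈ tripleHyperplane e := H ▸ AffineSubspace.mem_top _ _ _
  rw [mem_tripleHyperplane, Satisfies, Pi.single_eq_same, Pi.single_eq_of_ne he.symm] at h
  linarith

/-- The partition of the indices into the connected components of the graph of equations `S`. -/
def componentSetoid (S : Finset (Fin n × Fin n × ℤ)) : Setoid (Fin n) :=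
  Relation.EqvGen.setoid fun i j => ∃ c, (i, j, c) ∈ S

theorem forall_eq_iff_exists_comp_mk {α : Type*} {S : Finset (Fin n × Fin n × ℤ)} {x : Fin n → α} :
    (∀ e ∈ S, x e.1 = x e.2.1) ↔
      ∃ y : Quotient (componentSetoid S) → α, y ∘ Quotient.mk (componentSetoid S) = x := by
  constructor
  · intro H
    refine ⟨Quotient.lift x ?_, rfl⟩
    intro a b hab
    induction hab with
    | rel i j hij => obtain ⟨c, hc⟩ := hij; exact H _ hc
    | refl => rfl
    | symm _ _ _ ih => exact ih.symm
    | trans _ _ _ _ _ ih1 ih2 => exact ih1.trans ih2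
  · rintro ⟨y, rfl⟩ e he
    exact congrArg y (Quotient.sound (Relation.EqvGen.rel _ _ ⟨e.2.2, he⟩))

open scoped Classical in
-- The homogeneous system says that a vector is constant on each component, so there is one degree
-- of freedom per component.
theorem finrank_direction_flat {S : Finset (Fin n × Fin n × ℤ)} {p : Fin n → ℝ}
    (hp : p ∈ flat tripleHyperplane S) :
    Module.finrank ℝ (flat tripleHyperplane S).direction =
      Fintype.card (Quotient (componentSetoid S)) := by
  have hdir : (flat tripleHyperplane S).direction =
      LinearMap.range (LinearMap.funLeft ℝ ℝ (Quotient.mk (componentSetoid S))) := by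
    ext v
    rw [← AffineSubspace.vadd_mem_iff_mem_direction v hp, LinearMap.mem_range]
    refine Iff.trans ?_ forall_eq_iff_exists_comp_mk
    rw [mem_flat] at hp ⊢
    refine forall₂_congr fun e he => ?_
    have := hp e he
    simp only [mem_tripleHyperplane, Satisfies, vadd_eq_add, Pi.add_apply] at this ⊢
    constructor <;> intro h <;> linarith
  rw [hdir, LinearMap.finrank_range_of_inj
    (LinearMap.funLeft_injective_of_surjective _ _ _ Quotient.mk_surjective),
    Module.finrank_fintype_fun_eq_card]

open scoped Classical in
-- Translating by the integral solution `p` reduces to the homogeneous system, whose solutions are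
-- the functions constant on components.
theorem card_satisfies_eq {S : Finset (Fin n × Fin n × ℤ)} {p : Fin n → ℤ}
    (hp : ∀ e ∈ S, Satisfies p e) (m : ℕ) [NeZero m] :
    (Finset.univ.filter fun x : Fin n → ZMod m => ∀ e ∈ S, Satisfies x e).card =
      m ^ Fintype.card (Quotient (componentSetoid S)) := by
  have hcard : (Finset.univ : Finset (Quotient (componentSetoid S) → ZMod m)).card =
      m ^ Fintype.card (Quotient (componentSetoid S)) := by simp [ZMod.card]
  rw [← hcard]
  symm
  refine Finset.card_bij (fun y _ => fun i => y (Quotient.mk _ i) + (p i : ZMod m)) ?_ ?_ ?_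
  · intro y _
    simp only [Finset.mem_filter, Finset.mem_univ, true_and]
    intro e he
    have h1 := forall_eq_iff_exists_comp_mk.2 ⟨y, rfl⟩ e he
    have h2 : (p e.1 : ZMod m) = p e.2.1 + e.2.2 := by exact_mod_cast congrArg _ (hp e he)
    simp only [Function.comp_apply] at h1
    simp only [Satisfies, h1, h2]
    ring
  · intro y _ z _ hyz
    funext a
    induction a using Quotient.inductionOn with
    | h i => simpa using congrFun hyz i
  · intro x hx
    simp only [Finset.mem_filter, Finset.mem_univ, true_and] at hx
    obtain ⟨y, hy⟩ := (forall_eq_iff_exists_comp_mk (S := S)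
      (x := fun i => x i - (p i : ZMod m))).1 fun e he => by
        have h2 : (p e.1 : ZMod m) = p e.2.1 + e.2.2 := by exact_mod_cast congrArg _ (hp e he)
        have h3 := hx e he
        simp only [Satisfies] at h3
        rw [h2, h3]
        ring
    refine ⟨y, Finset.mem_univ _, ?_⟩
    funext i
    have := congrFun hy i
    simp only [Function.comp_apply] at this
    rw [this]
    ring

/-- A real solution of a system of difference equations with integer constants gives an integral
one by rounding down. -/
theorem exists_int_satisfies {S : Finset (Fin n × Fin n × ℤ)} {x : Fin n → ℝ}
    (hx : ∀ e ∈ S, Satisfies x e) : ∃ p : Fin n → ℤ, ∀ e ∈ S, Satisfies p e := by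
  refine ⟨fun i => ⌊x i⌋, fun e he => ?_⟩
  have := hx e he
  simp only [Satisfies] at this ⊢
  rw [this, Int.floor_add_intCast, Int.cast_id]

/-- Constants add up along a path of equations. The offset is chosen before `m` and `x`, which makes
a threshold for `m` possible. -/
theorem exists_offset {S : Finset (Fin n × Fin n × ℤ)} {i j : Fin n}
    (h : (componentSetoid S) i j) :
    ∃ d : ℤ, ∀ (m : ℕ) (x : Fin n → ZMod m), (∀ e ∈ S, Satisfies x e) → x i = x j + d := by
  induction h with
  | rel i j hij => obtain ⟨c, hc⟩ := hij; exact ⟨c, fun m x hx => hx _ hc⟩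
  | refl => exact ⟨0, by simp⟩
  | symm i j _ ih =>
    obtain ⟨d, hd⟩ := ih
    exact ⟨-d, fun m x hx => by rw [hd m x hx]; push_cast; ring⟩
  | trans i j k _ _ ih1 ih2 =>
    obtain ⟨d1, hd1⟩ := ih1
    obtain ⟨d2, hd2⟩ := ih2
    exact ⟨d2 + d1, fun m x hx => by rw [hd1 m x hx, hd2 m x hx]; push_cast; ring⟩

/-- A system of difference equations without integral solution has no solution modulo `m`
for large `m`. -/
theorem eventually_not_satisfies {S : Finset (Fin n × Fin n × ℤ)}
    (hS : ¬ ∃ p : Fin n → ℤ, ∀ e ∈ S, Satisfies p e) :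
    ∀ᶠ m : ℕ in Filter.atTop, ∀ x : Fin n → ZMod m, ¬ ∀ e ∈ S, Satisfies x e := by
  -- The offsets from a chosen representative of each component form a candidate integral solution
  -- `p`. It violates some equation, and any solution mod `m` forces `m` to divide the nonzero
  -- defect.
  have hoff : ∀ i : Fin n, ∃ d : ℤ, ∀ (m : ℕ) (x : Fin n → ZMod m),
      (∀ e ∈ S, Satisfies x e) →
        x i = x (Quotient.out (Quotient.mk (componentSetoid S) i)) + d := fun i =>
    exists_offset ((componentSetoid S).symm (Quotient.mk_out (s := componentSetoid S) i))
  choose p hp using hoff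
  push Not at hS
  obtain ⟨e, he, hne⟩ := hS p
  have hd : p e.1 - (p e.2.1 + e.2.2) ≠ 0 := by
    intro h
    apply hne
    simp only [Satisfies, Int.cast_id]
    linarith
  filter_upwards [Filter.eventually_gt_atTop (p e.1 - (p e.2.1 + e.2.2)).natAbs] with m hm x hx
  have h1 := hp e.1 m x hx
  have h2 := hp e.2.1 m x hx
  have h3 := hx e he
  have hq : Quotient.mk (componentSetoid S) e.1 = Quotient.mk (componentSetoid S) e.2.1 :=
    Quotient.sound (Relation.EqvGen.rel _ _ ⟨e.2.2, he⟩)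
  rw [hq] at h1
  simp only [Satisfies] at h3
  rw [h1, h2] at h3
  have h4 : ((p e.1 - (p e.2.1 + e.2.2) : ℤ) : ZMod m) = 0 := by
    push_cast
    linear_combination h3
  rw [ZMod.intCast_zmod_eq_zero_iff_dvd] at h4
  exact hd (Int.eq_zero_of_dvd_of_natAbs_lt_natAbs h4 (by simpa using hm))

open scoped Classical in
theorem eventually_card_satisfies (S : Finset (Fin n × Fin n × ℤ)) :
    ∀ᶠ m : ℕ in Filter.atTop, ∀ _ : NeZero m,
      ((Finset.univ.filter fun x : Fin n → ZMod m => ∀ e ∈ S, Satisfies x e).card : ℤ) =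
        if (flat tripleHyperplane S : Set (Fin n → ℝ)).Nonempty then
          (m : ℤ) ^ Module.finrank ℝ (flat tripleHyperplane S).direction else 0 := by
  by_cases hne : (flat tripleHyperplane S : Set (Fin n → ℝ)).Nonempty
  · obtain ⟨x, hx⟩ := hne
    obtain ⟨p, hp⟩ := exists_int_satisfies (S := S) (x := x) (mem_flat.1 hx)
    refine Filter.Eventually.of_forall fun m _ => ?_
    rw [if_pos ⟨x, hx⟩, card_satisfies_eq hp, finrank_direction_flat hx]
    push_cast
    rfl
  · have hno : ¬ ∃ p : Fin n → ℤ, ∀ e ∈ S, Satisfies p e := by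
      rintro ⟨p, hp⟩
      refine hne ⟨fun i => (p i : ℝ), mem_flat.2 fun e he => ?_⟩
      rw [mem_tripleHyperplane]
      have := hp e he
      simp only [Satisfies, Int.cast_id] at this ⊢
      exact_mod_cast this
    filter_upwards [eventually_not_satisfies hno] with m hm _
    rw [if_neg hne, Nat.cast_eq_zero, Finset.card_eq_zero, Finset.filter_eq_empty_iff]
    exact fun x _ => hm x

open scoped Classical in
/-- The finite field method: for large `m`, the characteristic polynomial of an arrangement of
hyperplanes `x_i = x_j + c` counts the points of `(ℤ/m)ⁿ` on none of the hyperplanes. -/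
theorem eventually_charPoly_eval (E : Finset (Fin n × Fin n × ℤ)) (hE : ∀ e ∈ E, e.1 ≠ e.2.1) :
    ∀ᶠ m : ℕ in Filter.atTop, ∀ _ : NeZero m,
      (charPoly (E.image tripleHyperplane)).eval (m : ℤ) =
        (Finset.univ.filter fun x : Fin n → ZMod m => ∀ e ∈ E, ¬ Satisfies x e).card := by
  have hall : ∀ᶠ m : ℕ in Filter.atTop, ∀ S ∈ E.powerset, ∀ _ : NeZero m,
      ((Finset.univ.filter fun x : Fin n → ZMod m => ∀ e ∈ S, Satisfies x e).card : ℤ) =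
        if (flat tripleHyperplane S : Set (Fin n → ℝ)).Nonempty then
          (m : ℤ) ^ Module.finrank ℝ (flat tripleHyperplane S).direction else 0 :=
    (Filter.eventually_all_finset _).2 fun S _ => eventually_card_satisfies S
  filter_upwards [hall] with m hm _
  rw [charPoly_eval_eq _ _ fun e he => tripleHyperplane_ne_top (hE e he)]
  rw [Finset.sum_congr rfl fun S hS => by rw [← hm S hS inferInstance]]
  simp only [Finset.card_filter, Nat.cast_sum, Finset.mul_sum]
  -- For fixed `x`, the alternating sum over the subsets of equations satisfied by `x` is 1 if `x`
  -- satisfies none and 0 otherwise.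
  rw [Finset.sum_comm]
  refine Finset.sum_congr rfl fun x _ => ?_
  have := sum_powerset_filter_neg_one_pow E fun e => Satisfies x e
  rw [Finset.sum_filter] at this
  push_cast
  rw [← this]
  exact Finset.sum_congr rfl fun S _ => by split_ifs <;> simp

end DifferenceEquations

/-! ### Occupied cells below a given one -/

section Runs

variable {ι : Type*} [Fintype ι]

/-- The number of values of `u` that are smaller than `u i`. -/
def numBelow (u : ι → ℕ) (i : ι) : ℕ :=
  (Finset.univ.filter fun l => u l < u i).card

theorem card_between_le {u : ι → ℕ} (hu : Function.Injective u) (a b : ℕ) :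
    (Finset.univ.filter fun l => a ≤ u l ∧ u l < b).card ≤ b - a := by
  rw [← Nat.card_Ico]
  refine Finset.card_le_card_of_injOn u ?_ hu.injOn
  intro l hl
  simpa using hl

theorem numBelow_split {u : ι → ℕ} {i j : ι} (h : u i ≤ u j) :
    numBelow u j = numBelow u i + (Finset.univ.filter fun l => u i ≤ u l ∧ u l < u j).card := by
  classical
  unfold numBelow
  rw [← Finset.card_union_of_disjoint]
  · congr 1
    ext l
    simp only [Finset.mem_filter, Finset.mem_univ, true_and, Finset.mem_union]
    omega
  · rw [Finset.disjoint_left]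
    intro l
    simp only [Finset.mem_filter, Finset.mem_univ, true_and]
    omega

/-- The values below `u i` are distinct cells of `[b, u i)`. With `b = 0` this shows that `u i -
numBelow u i`, the number of empty cells below `u i`, is not truncated. -/
theorem numBelow_add_le {u : ι → ℕ} (hu : Function.Injective u) {b : ℕ} (hb : ∀ l, b ≤ u l)
    (i : ι) : numBelow u i + b ≤ u i := by
  have h1 := card_between_le hu b (u i)
  have h2 : numBelow u i ≤ u i - b := by
    refine le_trans (Finset.card_le_card fun l hl => ?_) h1
    simp only [Finset.mem_filter, Finset.mem_univ, true_and] at hl ⊢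
    exact ⟨hb l, hl⟩
  have := hb i
  omega

theorem add_card_le_numBelow_add {u : ι → ℕ} (hu : Function.Injective u) {M : ℕ}
    (hM : ∀ l, u l < M) (i : ι) : u i + Fintype.card ι ≤ numBelow u i + M := by
  have h1 := card_between_le hu (u i) M
  have h2 := Finset.card_filter_add_card_filter_not (s := Finset.univ) (fun l => u l < u i)
  have h3 : (Finset.univ.filter fun l => ¬ u l < u i).card ≤ M - u i := by
    refine le_trans (Finset.card_le_card fun l hl => ?_) h1
    simp only [Finset.mem_filter, Finset.mem_univ, true_and] at hl ⊢
    exact ⟨by omega, hM l⟩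
  have := hM i
  rw [Finset.card_univ] at h2
  unfold numBelow
  omega

end Runs

/-! ### Placements with decreasing runs -/

section TieBreaking

variable {ι : Type*} [LinearOrder ι]

/-- The strict total order on the index set that compares values and breaks ties by decreasing
index. -/
def TieLT (f : ι → ℕ) (l i : ι) : Prop :=
  f l < f i ∨ (f l = f i ∧ i < l)

theorem not_tieLT_self (f : ι → ℕ) (i : ι) : ¬ TieLT f i i := by
  simp [TieLT]

theorem tieLT_trichotomy (f : ι → ℕ) {l i : ι} (h : l ≠ i) : TieLT f l i ∨ TieLT f i l := by
  unfold TieLT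
  rcases lt_trichotomy (f l) (f i) with h1 | h1 | h1
  · exact Or.inl (Or.inl h1)
  · rcases lt_or_gt_of_ne h with h2 | h2
    · exact Or.inr (Or.inr ⟨h1.symm, h2⟩)
    · exact Or.inl (Or.inr ⟨h1, h2⟩)
  · exact Or.inr (Or.inl h1)

variable [Fintype ι]

open scoped Classical in
/-- The number of predecessors of `i` in the order `TieLT f`. -/
noncomputable def tieRank (f : ι → ℕ) (i : ι) : ℕ :=
  (Finset.univ.filter fun l => TieLT f l i).card

theorem tieRank_lt_tieRank {f : ι → ℕ} {l i : ι} (h : TieLT f l i) : tieRank f l < tieRank f i := by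
  classical
  refine Finset.card_lt_card ⟨?_, fun H => ?_⟩
  · intro a ha
    simp only [Finset.mem_filter, Finset.mem_univ, true_and] at ha ⊢
    unfold TieLT at ha h ⊢
    rcases ha with ha | ⟨ha, ha'⟩ <;> rcases h with h | ⟨h, h'⟩
    · left; omega
    · left; omega
    · left; omega
    · right; exact ⟨ha.trans h, h'.trans ha'⟩
  · have := H (Finset.mem_filter.2 ⟨Finset.mem_univ l, h⟩)
    exact not_tieLT_self f l (Finset.mem_filter.1 this).2

theorem tieRank_lt_card (f : ι → ℕ) (i : ι) : tieRank f i < Fintype.card ι := by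
  classical
  refine Finset.card_lt_univ_of_notMem (x := i) ?_
  exact fun h => not_tieLT_self f i (Finset.mem_filter.1 h).2

theorem add_tieRank_lt {f : ι → ℕ} {l i : ι} (h : TieLT f l i) :
    f l + tieRank f l < f i + tieRank f i := by
  have h1 := tieRank_lt_tieRank h
  rcases h with h | h <;> omega

theorem add_tieRank_lt_iff {f : ι → ℕ} {l i : ι} :
    f l + tieRank f l < f i + tieRank f i ↔ TieLT f l i := by
  refine ⟨fun h => ?_, add_tieRank_lt⟩
  have hne : l ≠ i := by rintro rfl; exact lt_irrefl _ h
  rcases tieLT_trichotomy f hne with h1 | h1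
  · exact h1
  · exact absurd (add_tieRank_lt h1) (by omega)

theorem numBelow_add_tieRank (f : ι → ℕ) (i : ι) :
    numBelow (fun l => f l + tieRank f l) i = tieRank f i := by
  classical
  rw [numBelow, tieRank]
  congr 1
  ext l
  simp only [Finset.mem_filter, Finset.mem_univ, true_and]
  exact add_tieRank_lt_iff (f := f) (l := l) (i := i)

/-- If `u` never places a larger index right after a smaller one, then the number of empty cells
below determines the relative order of two indices up to ties, which are broken by `TieLT`. -/
theorem tieLT_sub_numBelow {u : ι → ℕ} (hu : Function.Injective u)
    (hrun : ∀ p q, p < q → u q ≠ u p + 1) {i j : ι} (h : u i < u j) :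
    TieLT (fun l => u l - numBelow u l) i j := by
  have h1 := numBelow_split h.le
  have h2 := card_between_le hu (u i) (u j)
  have h3 := numBelow_add_le hu (b := 0) (by simp) i
  have h4 := numBelow_add_le hu (b := 0) (by simp) j
  -- Equality means that no cell between `u i` and `u j` is empty, which is the case of a tie.
  by_cases heq : (Finset.univ.filter fun l => u i ≤ u l ∧ u l < u j).card = u j - u i
  · right
    refine ⟨by dsimp only; omega, ?_⟩
    have himage : (Finset.univ.filter fun l => u i ≤ u l ∧ u l < u j).image u =
        Finset.Ico (u i) (u j) := by
      refine Finset.eq_of_subset_of_card_le ?_ ?_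
      · intro c hc
        simp only [Finset.mem_image, Finset.mem_filter, Finset.mem_univ, true_and] at hc
        obtain ⟨l, hl, rfl⟩ := hc
        exact Finset.mem_Ico.2 hl
      · rw [Finset.card_image_of_injective _ hu, heq, Nat.card_Ico]
    have hfull : ∀ c, u i ≤ c → c ≤ u j → ∃ l, u l = c := by
      intro c hc1 hc2
      rcases hc2.eq_or_lt with rfl | hc2
      · exact ⟨j, rfl⟩
      · have : c ∈ Finset.Ico (u i) (u j) := Finset.mem_Ico.2 ⟨hc1, hc2⟩
        rw [← himage, Finset.mem_image] at this
        obtain ⟨l, -, hl⟩ := this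
        exact ⟨l, hl⟩
    -- Going up through consecutive occupied cells, the index never increases.
    have hchain : ∀ d, u i + d ≤ u j → ∃ l, u l = u i + d ∧ l ≤ i := by
      intro d
      induction d with
      | zero => exact fun _ => ⟨i, rfl, le_rfl⟩
      | succ d ih =>
        intro hd
        obtain ⟨l, hl, hli⟩ := ih (by omega)
        obtain ⟨l', hl'⟩ := hfull (u i + (d + 1)) (by omega) hd
        refine ⟨l', hl', le_trans (not_lt.1 fun hlt => hrun l l' hlt ?_) hli⟩
        omega
    obtain ⟨l, hl, hli⟩ := hchain (u j - u i) (by omega)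
    have hlj : l = j := hu (by omega)
    subst hlj
    refine lt_of_le_of_ne hli ?_
    rintro rfl
    exact lt_irrefl _ h
  · left
    dsimp only
    omega

theorem tieRank_sub_numBelow {u : ι → ℕ} (hu : Function.Injective u)
    (hrun : ∀ p q, p < q → u q ≠ u p + 1) (i : ι) :
    tieRank (fun l => u l - numBelow u l) i = numBelow u i := by
  classical
  unfold tieRank
  rw [numBelow]
  congr 1
  ext l
  simp only [Finset.mem_filter, Finset.mem_univ, true_and]
  refine ⟨fun h => ?_, tieLT_sub_numBelow hu hrun⟩
  by_contra hlt
  rcases (not_lt.1 hlt).eq_or_lt with h1 | h1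
  · have := hu h1
    subst this
    simp [TieLT] at h
  · have h2 := tieRank_lt_tieRank (tieLT_sub_numBelow hu hrun h1)
    have h3 := tieRank_lt_tieRank h
    omega

open scoped Classical in
/-- The number of injective placements of `ι` into `[b, M)` in which no index is directly followed
by a larger one. -/
theorem card_decreasing_runs (b M : ℕ) (hM : b + Fintype.card ι ≤ M) :
    ((Fintype.piFinset fun _ : ι => Finset.Ico b M).filter fun u =>
      Function.Injective u ∧ ∀ p q, p < q → u q ≠ u p + 1).card =
      (M + 1 - Fintype.card ι - b) ^ Fintype.card ι := by
  have hcard : (Fintype.piFinset fun _ : ι => Finset.Icc b (M - Fintype.card ι)).card =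
      (M + 1 - Fintype.card ι - b) ^ Fintype.card ι := by
    rw [Fintype.card_piFinset, Finset.prod_const, Nat.card_Icc, Finset.card_univ]
    congr 1
    omega
  rw [← hcard]
  -- Record for each index the number of empty cells below it; conversely, shift each index up by
  -- its rank, which restores the occupied cells.
  refine Finset.card_nbij' (fun u i => u i - numBelow u i) (fun f i => f i + tieRank f i) ?_ ?_ ?_ ?_
  · intro u hu
    simp only [Finset.coe_filter, Set.mem_ofPred_eq, Fintype.mem_piFinset, Finset.mem_Ico,
      Finset.mem_coe, Finset.mem_Icc] at hu ⊢
    intro i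
    have h1 := numBelow_add_le hu.2.1 (fun l => (hu.1 l).1) i
    have h2 := add_card_le_numBelow_add hu.2.1 (fun l => (hu.1 l).2) i
    omega
  · intro f hf
    simp only [Finset.coe_filter, Set.mem_ofPred_eq, Fintype.mem_piFinset, Finset.mem_Ico,
      Finset.mem_coe, Finset.mem_Icc] at hf ⊢
    refine ⟨fun i => ?_, fun l i h => ?_, fun p q hpq h => ?_⟩
    · have h1 := tieRank_lt_card f i
      have h2 := hf i
      omega
    · by_contra hne
      dsimp only at h
      rcases tieLT_trichotomy f hne with h1 | h1 <;> have := add_tieRank_lt h1 <;> omega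
    -- Since ranks strictly increase, adjacent cells can only come from a tie, and ties put the
    -- larger index first.
    · have h1 : TieLT f p q := add_tieRank_lt_iff.1 (by omega)
      have h2 := tieRank_lt_tieRank h1
      rcases h1 with h1 | h1
      · omega
      · exact lt_asymm hpq h1.2
  · intro u hu
    simp only [Finset.coe_filter, Set.mem_ofPred_eq] at hu
    funext i
    have h1 := numBelow_add_le hu.2.1 (b := 0) (by simp) i
    dsimp only
    rw [tieRank_sub_numBelow hu.2.1 hu.2.2]
    omega
  · intro f _
    funext i
    dsimp only
    rw [numBelow_add_tieRank]
    omega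

end TieBreaking

/-! ### Placements with staggered lower bounds -/

open scoped Classical in
/-- Injective placements of `r + s` indices below `M`, with lower bounds increasing from `b` to
`b + s`, such that no index from `s` on is directly followed by a larger one. -/
noncomputable def placements (r s b M : ℕ) : Finset (Fin (r + s) → ℕ) :=
  (Fintype.piFinset fun p : Fin (r + s) => Finset.Ico (b + min s p) M).filter fun u =>
    Function.Injective u ∧ ∀ p q : Fin (r + s), p < q → s ≤ p → u q ≠ u p + 1

theorem mem_placements {r s b M : ℕ} {u : Fin (r + s) → ℕ} :
    u ∈ placements r s b M ↔ (∀ p : Fin (r + s), b + min s p ≤ u p ∧ u p < M) ∧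
      Function.Injective u ∧ ∀ p q : Fin (r + s), p < q → s ≤ p → u q ≠ u p + 1 := by
  simp [placements]

/-- Index 0 has the weakest bound and no adjacency condition. The other `r + s` indices all lie in
`[b, M)`, so whatever their positions it has `M - b - (r + s)` free cells. -/
theorem card_placements_succ (r s b M : ℕ) :
    (placements r (s + 1) b M).card = (placements r s (b + 1) M).card * (M - b - (r + s)) := by
  classical
  have hfib : ∀ u ∈ placements r s (b + 1) M,
      (Finset.Ico b M \ Finset.univ.image u).card = M - b - (r + s) := by
    intro u hu
    rw [mem_placements] at hu
    rw [Finset.card_sdiff_of_subset, Nat.card_Ico, Finset.card_image_of_injective _ hu.2.1,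
      Finset.card_univ, Fintype.card_fin]
    intro c hc
    simp only [Finset.mem_image, Finset.mem_univ, true_and] at hc
    obtain ⟨p, rfl⟩ := hc
    have := hu.1 p
    exact Finset.mem_Ico.2 ⟨by omega, this.2⟩
  rw [← smul_eq_mul, ← Finset.sum_const, ← Finset.sum_congr rfl hfib, ← Finset.card_sigma]
  symm
  refine Finset.card_bij (fun a _ => (Fin.cons a.2 a.1 : Fin (r + s + 1) → ℕ)) ?_ ?_ ?_
  · rintro ⟨u, v⟩ h
    simp only [Finset.mem_sigma, mem_placements, Finset.mem_sdiff, Finset.mem_Ico,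
      Finset.mem_image, Finset.mem_univ, true_and] at h
    obtain ⟨⟨h1, h2, h3⟩, h4, h5⟩ := h
    refine mem_placements.2 ⟨fun p => ?_, ?_, fun p q hpq hp => ?_⟩
    · refine Fin.cases ?_ (fun p => ?_) p
      · simpa using h4
      · have := h1 p
        simp only [Fin.cons_succ, Fin.val_succ]
        omega
    · exact Fin.cons_injective_iff.2 ⟨by simpa using h5, h2⟩
    · obtain ⟨p, rfl⟩ := Fin.exists_succ_eq_of_ne_zero (x := p) (by rintro rfl; simp at hp)
      obtain ⟨q, rfl⟩ := Fin.exists_succ_eq_of_ne_zero (x := q) (by rintro rfl; simp at hpq)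
      simpa using h3 p q (by simpa using hpq) (by simpa using hp)
  · rintro ⟨u, v⟩ _ ⟨u', v'⟩ _ h
    obtain ⟨h1, h2⟩ := Fin.cons_injective2 h
    dsimp only at h1 h2
    rw [h1, h2]
  · intro w hw
    obtain ⟨h1, h2, h3⟩ := mem_placements.1 hw
    refine ⟨⟨Fin.tail w, w 0⟩, ?_, Fin.cons_self_tail w⟩
    simp only [Finset.mem_sigma, mem_placements, Finset.mem_sdiff, Finset.mem_Ico,
      Finset.mem_image, Finset.mem_univ, true_and]
    refine ⟨⟨fun p => ?_, fun p q h => ?_, fun p q hpq hp => ?_⟩, ?_, ?_⟩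
    · have := h1 p.succ
      simp only [Fin.val_succ] at this
      simp only [Fin.tail]
      omega
    · exact Fin.succ_injective _ (h2 h)
    · exact h3 p.succ q.succ (by simpa using hpq) (by simpa using hp)
    · simpa using h1 0
    · rintro ⟨p, hp⟩
      exact Fin.succ_ne_zero p (h2 hp)

/-- Passing from `s + 1` to `s` raises `b` by one, so the base of the power is unchanged and equals
the new factor `M - b - (r + s)`. -/
theorem card_placements (r s b M : ℕ) (hM : b + r + s ≤ M) :
    (placements r s b M).card = (M + 1 - r - s - b) ^ (r + s) := by
  classical
  induction s generalizing b with
  | zero =>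
    have := card_decreasing_runs (ι := Fin r) b M (by simpa using hM)
    rw [Fintype.card_fin] at this
    simp only [Nat.sub_zero, Nat.add_zero]
    rw [← this]
    congr 1
    ext u
    simp [placements]
  | succ s ih =>
    rw [card_placements_succ, ih (b + 1) (by omega), ← Nat.add_assoc, pow_succ]
    congr 1
    · congr 1
      omega
    · omega

/-! ### Counting points off the arrangement -/

open scoped Classical in
/-- The equations of the hyperplanes of `between n X`. -/
noncomputable def betweenTriples (n : ℕ) (X : Finset ℕ) : Finset (Fin n × Fin n × ℤ) :=
  (pairs n).image (fun p => (p.1, p.2, 0)) ∪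
    ((pairs n).filter fun p => (p.1 : ℕ) + 1 ∈ X).image (fun p => (p.1, p.2, 1)) ∪
    ((pairs n).filter fun p => (p.1 : ℕ) + 1 ∉ X).image
      (fun p => (⟨0, p.1.pos⟩, p.2, (((p.1 : ℕ) + 1 : ℕ) : ℤ)))

open scoped Classical in
theorem between_eq_image (n : ℕ) (X : Finset ℕ) :
    between n X = (betweenTriples n X).image tripleHyperplane := by
  simp only [between, betweenTriples, cox, Finset.image_union, Finset.image_image]
  congr 1
  · congr 1
    · refine Finset.image_congr fun p _ => ?_
      simp [tripleHyperplane, coxHyperplane]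
    · refine Finset.image_congr fun p _ => ?_
      simp [tripleHyperplane, shiHyperplane]

theorem forall_mem_betweenTriples {n : ℕ} {X : Finset ℕ} {P : Fin n × Fin n × ℤ → Prop} :
    (∀ e ∈ betweenTriples n X, P e) ↔
      (∀ i j : Fin n, i < j → P (i, j, 0)) ∧
      (∀ i j : Fin n, i < j → (i : ℕ) + 1 ∈ X → P (i, j, 1)) ∧
      (∀ i j : Fin n, i < j → (i : ℕ) + 1 ∉ X →
        P (⟨0, i.pos⟩, j, (((i : ℕ) + 1 : ℕ) : ℤ))) := by
  classical
  simp only [betweenTriples, Finset.forall_mem_union, Finset.forall_mem_image, pairs,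
    Finset.mem_filter, Finset.mem_univ, true_and, Prod.forall, and_imp, and_assoc]

theorem natCast_zmod_inj_of_lt {m a b : ℕ} (ha : a < m) (hb : b < m) :
    (a : ZMod m) = (b : ZMod m) ↔ a = b := by
  rw [ZMod.natCast_eq_natCast_iff', Nat.mod_eq_of_lt ha, Nat.mod_eq_of_lt hb]

/-- A point of `(ℤ/m)ⁿ`, written in terms of its first coordinate and the differences to it, avoids
the arrangement if and only if the differences form a placement. -/
theorem avoids_cons_iff (r s m : ℕ) (hm : r + s + 1 < m) (a : ZMod m)
    (u : Fin (r + s) → ℕ) (hu : ∀ p, u p < m) :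
    (∀ e ∈ betweenTriples (r + s + 1) (Finset.Ioo (s + 1) (r + s + 1)),
      ¬ Satisfies (Fin.cons a (fun p => a - (u p : ZMod m)) : Fin (r + s + 1) → ZMod m) e) ↔
      u ∈ placements r s 2 m := by
  have hz : (⟨0, Nat.succ_pos _⟩ : Fin (r + s + 1)) = 0 := rfl
  rw [forall_mem_betweenTriples, mem_placements]
  constructor
  · rintro ⟨hC, hS, hI⟩
    have hlow : ∀ p : Fin (r + s), 2 + min s p ≤ u p := by
      intro p
      by_contra hlt
      have hp := p.isLt
      rcases Nat.eq_zero_or_pos (u p) with h0 | h0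
      · exact hC 0 p.succ (Fin.succ_pos p) (by simp [Satisfies, h0])
      · refine hI ⟨u p - 1, by omega⟩ p.succ (by rw [Fin.lt_def, Fin.val_succ]; dsimp only; omega)
          (by simp only [Finset.mem_Ioo]; omega) ?_
        simp only [Satisfies, hz, Fin.cons_zero, Fin.cons_succ]
        rw [Nat.sub_add_cancel h0]
        push_cast
        ring
    refine ⟨fun p => ⟨hlow p, hu p⟩, ?_, ?_⟩
    · have hlt : ∀ p q : Fin (r + s), p < q → u p ≠ u q := fun p q hpq h =>
        hC p.succ q.succ (Fin.succ_lt_succ_iff.2 hpq) (by simp [Satisfies, h])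
      intro p q h
      by_contra hne
      rcases lt_or_gt_of_ne hne with h1 | h1
      · exact hlt p q h1 h
      · exact hlt q p h1 h.symm
    · intro p q hpq hp h
      have hq := q.isLt
      have hpq' := Fin.lt_def.1 hpq
      refine hS p.succ q.succ (Fin.succ_lt_succ_iff.2 hpq)
        (by simp only [Finset.mem_Ioo, Fin.val_succ]; omega) ?_
      simp only [Satisfies, Fin.cons_succ, h]
      push_cast
      ring
  · rintro ⟨hb, hinj, hrun⟩
    refine ⟨fun i j hij h => ?_, fun i j hij hX h => ?_, fun i j hij hX h => ?_⟩
    · obtain ⟨q, rfl⟩ := Fin.exists_succ_eq_of_ne_zero (x := j) (by rintro rfl; simp at hij)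
      have hq := hb q
      revert hij h
      refine Fin.cases (fun _ h => ?_) (fun p hij h => ?_) i
      · have : ((u q : ℕ) : ZMod m) = ((0 : ℕ) : ZMod m) := by
          simp only [Satisfies, Fin.cons_zero, Fin.cons_succ] at h
          push_cast at h ⊢
          linear_combination h
        rw [natCast_zmod_inj_of_lt hq.2 (by omega)] at this
        omega
      · have : ((u q : ℕ) : ZMod m) = ((u p : ℕ) : ZMod m) := by
          simp only [Satisfies, Fin.cons_succ] at h
          push_cast at h ⊢
          linear_combination h
        rw [natCast_zmod_inj_of_lt hq.2 (hu p)] at this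
        have := hinj this
        subst this
        exact lt_irrefl _ hij
    · obtain ⟨q, rfl⟩ := Fin.exists_succ_eq_of_ne_zero (x := j) (by rintro rfl; simp at hij)
      obtain ⟨p, rfl⟩ := Fin.exists_succ_eq_of_ne_zero (x := i) (by rintro rfl; simp at hX)
      have hq := hb q
      have hp := hu p
      simp only [Finset.mem_Ioo, Fin.val_succ] at hX
      have h1 : ((u q : ℕ) : ZMod m) = ((u p + 1 : ℕ) : ZMod m) := by
        simp only [Satisfies, Fin.cons_succ] at h
        push_cast at h ⊢
        linear_combination h
      rcases Nat.lt_or_ge (u p + 1) m with hlt | hge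
      · rw [natCast_zmod_inj_of_lt hq.2 hlt] at h1
        exact hrun p q (Fin.succ_lt_succ_iff.1 hij) (by omega) h1
      -- Wrapping around modulo `m` would need `u q = 0`, which the lower bound 2 excludes.
      · have h2 : u p + 1 = m := by omega
        have h3 : ((u q : ℕ) : ZMod m) = ((0 : ℕ) : ZMod m) := by
          rw [h1, h2, ZMod.natCast_self, Nat.cast_zero]
        rw [natCast_zmod_inj_of_lt hq.2 (by omega)] at h3
        omega
    · obtain ⟨q, rfl⟩ := Fin.exists_succ_eq_of_ne_zero (x := j) (by rintro rfl; simp at hij)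
      have hq := hb q
      have hqlt := q.isLt
      have hij' := Fin.lt_def.1 hij
      simp only [Finset.mem_Ioo, Fin.val_succ] at hX hij'
      have h1 : ((u q : ℕ) : ZMod m) = (((i : ℕ) + 1 : ℕ) : ZMod m) := by
        simp only [Satisfies, hz, Fin.cons_zero, Fin.cons_succ] at h
        push_cast at h ⊢
        linear_combination h
      rw [natCast_zmod_inj_of_lt hq.2 (by omega)] at h1
      omega

theorem card_avoiding (r s m : ℕ) (hm : r + s + 1 < m) [NeZero m]
    [DecidablePred fun x : Fin (r + s + 1) → ZMod m =>
      ∀ e ∈ betweenTriples (r + s + 1) (Finset.Ioo (s + 1) (r + s + 1)), ¬ Satisfies x e] :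
    (Finset.univ.filter fun x : Fin (r + s + 1) → ZMod m =>
      ∀ e ∈ betweenTriples (r + s + 1) (Finset.Ioo (s + 1) (r + s + 1)), ¬ Satisfies x e).card =
      m * (m - (r + s + 1)) ^ (r + s) := by
  have hcard : ((Finset.univ : Finset (ZMod m)) ×ˢ placements r s 2 m).card =
      m * (m - (r + s + 1)) ^ (r + s) := by
    rw [Finset.card_product, Finset.card_univ, ZMod.card, card_placements _ _ _ _ (by omega)]
    congr 2
    omega
  rw [← hcard]
  symm
  refine Finset.card_bij
    (fun y _ => (Fin.cons y.1 (fun p => y.1 - (y.2 p : ZMod m)) : Fin (r + s + 1) → ZMod m))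
    ?_ ?_ ?_
  · rintro ⟨a, u⟩ h
    have hu := (Finset.mem_product.1 h).2
    rw [Finset.mem_filter]
    exact ⟨Finset.mem_univ _,
      (avoids_cons_iff r s m hm a u fun p => ((mem_placements.1 hu).1 p).2).2 hu⟩
  · rintro ⟨a, u⟩ h ⟨a', u'⟩ h' heq
    have hu := (mem_placements.1 (Finset.mem_product.1 h).2).1
    have hu' := (mem_placements.1 (Finset.mem_product.1 h').2).1
    obtain ⟨h1, h2⟩ := Fin.cons_injective2 heq
    dsimp only at h1 h2 hu hu'
    subst h1
    have : u = u' := by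
      funext p
      exact (natCast_zmod_inj_of_lt (hu p).2 (hu' p).2).1 (sub_right_injective (congrFun h2 p))
    rw [this]
  · intro x hx
    rw [Finset.mem_filter] at hx
    have hxe : x = Fin.cons (x 0) (fun p => x 0 - (((x 0 - x p.succ).val : ℕ) : ZMod m)) := by
      funext i
      refine Fin.cases ?_ (fun p => ?_) i
      · simp
      · simp
    refine ⟨(x 0, fun p => (x 0 - x p.succ).val), ?_, hxe.symm⟩
    refine Finset.mem_product.2 ⟨Finset.mem_univ _, ?_⟩
    refine (avoids_cons_iff r s m hm (x 0) _ fun p => ZMod.val_lt _).1 ?_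
    rw [← hxe]
    exact hx.2

/-- The characteristic polynomial of the arrangements between Shi and Ish. -/
theorem charPoly_between (k n : ℕ) (hk : 1 ≤ k) (hkn : k < n) :
    charPoly (between n (Finset.Ioo k n)) =
      Polynomial.X * (Polynomial.X - Polynomial.C (n : ℤ)) ^ (n - 1) := by
  classical
  -- Here k = s + 1 and r = n - k.
  obtain ⟨s, rfl⟩ := Nat.exists_eq_add_of_le' hk
  obtain ⟨r, rfl⟩ : ∃ r, n = r + s + 1 := ⟨n - s - 1, by omega⟩
  have hE : ∀ e ∈ betweenTriples (r + s + 1) (Finset.Ioo (s + 1) (r + s + 1)), e.1 ≠ e.2.1 := by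
    refine forall_mem_betweenTriples.2
      ⟨fun i j hij => hij.ne, fun i j hij _ => hij.ne, fun i j hij _ => ?_⟩
    exact (lt_of_le_of_lt (Fin.zero_le i) hij).ne
  obtain ⟨m₀, hm₀⟩ := Filter.eventually_atTop.1
    ((eventually_charPoly_eval _ hE).and (Filter.eventually_gt_atTop (r + s + 1)))
  rw [between_eq_image]
  refine Polynomial.eq_of_infinite_eval_eq _ _ (Set.Infinite.mono ?_
    ((Set.Ici_infinite m₀).image (f := fun m : ℕ => (m : ℤ)) Nat.cast_injective.injOn))
  rintro _ ⟨m, hm, rfl⟩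
  obtain ⟨h1, h2⟩ := hm₀ m hm
  have : NeZero m := ⟨by omega⟩
  simp only [Set.mem_ofPred_eq]
  have h3 : ((m * (m - (r + s + 1)) ^ (r + s) : ℕ) : ℤ) = Polynomial.eval (m : ℤ)
      (Polynomial.X * (Polynomial.X - Polynomial.C ((r + s + 1 : ℕ) : ℤ)) ^ (r + s + 1 - 1)) := by
    rw [Nat.cast_mul, Nat.cast_pow, Nat.cast_sub h2.le]
    simp
  rw [h1 this, ← h3, ← card_avoiding r s m h2]

/-! ### Shi and Ish as the extreme cases -/

theorem shi_eq_between (n : ℕ) : shi n = between n (Finset.Ioo 1 n) := by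
  classical
  ext H
  simp only [shi, between, Finset.mem_union, Finset.mem_image, Finset.mem_filter, pairs,
    Finset.mem_univ, true_and, Finset.mem_Ioo, or_assoc]
  refine or_congr_right ⟨?_, ?_⟩
  · rintro ⟨⟨i, j⟩, hij, rfl⟩
    have hij' := Fin.lt_def.1 hij
    have hj := j.isLt
    dsimp only at hij' hj ⊢
    by_cases h0 : (i : ℕ) = 0
    -- For i = 1 the hyperplanes S_{1j} and I_{1j} coincide.
    · refine Or.inr ⟨⟨i, j⟩, ⟨hij, by dsimp only; omega⟩, ?_⟩
      have hi : (⟨0, i.pos⟩ : Fin n) = i := Fin.ext h0.symm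
      simp [ishHyperplane, shiHyperplane, hi, h0]
    · exact Or.inl ⟨⟨i, j⟩, ⟨hij, by dsimp only; omega⟩, rfl⟩
  · rintro (⟨⟨i, j⟩, ⟨hij, -⟩, rfl⟩ | ⟨⟨i, j⟩, ⟨hij, h⟩, rfl⟩)
    · exact ⟨⟨i, j⟩, hij, rfl⟩
    · refine ⟨⟨i, j⟩, hij, ?_⟩
      have hij' := Fin.lt_def.1 hij
      have hj := j.isLt
      dsimp only at hij' hj h ⊢
      have h0 : (i : ℕ) = 0 := by omega
      have hi : (⟨0, i.pos⟩ : Fin n) = i := Fin.ext h0.symm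
      simp [ishHyperplane, shiHyperplane, hi, h0]

theorem ish_eq_between (n : ℕ) : ish n = between n (Finset.Ioo (n - 1) n) := by
  classical
  have h : Finset.Ioo (n - 1) n = ∅ := by
    ext i
    simp only [Finset.mem_Ioo, Finset.notMem_empty, iff_false]
    omega
  simp [ish, between, h]

end HyperplaneArrangement

theorem theorem2p2 (k n : ℕ) (hk : 1 ≤ k) (hkn : k < n) :
    HyperplaneArrangement.charPoly (HyperplaneArrangement.between n (Finset.Ioo k n)) =
        Polynomial.X * (Polynomial.X - Polynomial.C (n : ℤ)) ^ (n - 1) ∧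
      HyperplaneArrangement.charPoly (HyperplaneArrangement.between n (Finset.Ioo k n)) =
        HyperplaneArrangement.charPoly (HyperplaneArrangement.shi n) ∧
      HyperplaneArrangement.charPoly (HyperplaneArrangement.between n (Finset.Ioo k n)) =
        HyperplaneArrangement.charPoly (HyperplaneArrangement.ish n) := by
  rw [HyperplaneArrangement.shi_eq_between, HyperplaneArrangement.ish_eq_between,
    HyperplaneArrangement.charPoly_between k n hk hkn,
    HyperplaneArrangement.charPoly_between 1 n le_rfl (by omega),
    HyperplaneArrangement.charPoly_between (n - 1) n (by omega) (by omega)]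
  exact ⟨rfl, rfl, rfl⟩
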